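/- Let $d\ge 3$ and let $[0,1]^d$ carry the Euclidean metric. For $k\ge 1$ let $\lambda_k$ denote Lebesgue measure on $[0,1]^k$. Let $\mathcal{P}_d^{\lambda_{d-1}}$ be the set of all Borel probability measures $\mu$ on $[0,1]^d$ such that each one-dimensional marginal of $\mu$ equals $\lambda_1$ and, for each $j\in\{1,\dots,d\}$, the push-forward of $\mu$ under the projection $(x_1,\dots,x_d)\mapsto(x_1,\dots,x_{j-1},x_{j+1},\dots,x_d)$ equals $\lambda_{d-1}$. For Borel probability measures $\mu,\nu$ on $[0,1]^d$ let $$h(\mu,\nu)=\sup\Big\{\int g\,d\mu-\int g\,d\nu:\ g:[0,1]^d\to\mathbb{R},\ |g(x)-g(y)|\le \|x-y\|_2\ \text{for all } x,y\Big\}$$ be the Hutchinson metric (also called Wasserstein-1 or Kantorovich–Rubinstein metric). Write $\operatorname{supp}(\mu)$ for the topological support of $\mu$ and $\dim_H$ for Hausdorff dimension. Then: 1. The set of all $\mu\in\mathcal{P}_d^{\lambda_{d-1}}$ for which $\dim_H(\operatorname{supp}(\mu))$ is not an integer is dense in the metric space $(\mathcal{P}_d^{\lambda_{d-1}},h)$.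 2. More strongly, for every non-empty open interval $(a,b)$ with $d-1\le a<b\le d$, the set of all $\mu\in\mathcal{P}_d^{\lambda_{d-1}}$ with $\dim_H(\operatorname{supp}(\mu))\in(a,b)$ is dense in $(\mathcal{P}_d^{\lambda_{d-1}},h)$. -/

import Mathlib

open MeasureTheory

/-- The unit cube `[0,1]^ι`, a compact metric space with the Euclidean metric and the
Borel σ-algebra inherited from `ℝ^ι`. -/
abbrev Cube (ι : Type*) [Fintype ι] : Type _ :=
  {x : EuclideanSpace ℝ ι // ∀ i, x i ∈ Set.Icc (0 : ℝ) 1}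

/-- Lebesgue measure on the unit cube. -/
noncomputable def Cube.lebesgue (ι : Type*) [Fintype ι] : Measure (Cube ι) :=
  (volume : Measure (EuclideanSpace ℝ ι)).comap Subtype.val

/-- The projection of the cube onto the coordinate `j`. -/
def Cube.coord {ι : Type*} [Fintype ι] (j : ι) (x : Cube ι) : Set.Icc (0 : ℝ) 1 :=
  ⟨x.1 j, x.2 j⟩

/-- The projection of the cube onto all coordinates except `j`. -/
def Cube.drop {d : ℕ} (j : Fin d) (x : Cube (Fin d)) : Cube {i : Fin d // i ≠ j} :=
  ⟨WithLp.toLp 2 (fun i => x.1 i.1), fun i => x.2 i.1⟩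

theorem Cube.measurable_coord {ι : Type*} [Fintype ι] (j : ι) :
    Measurable (Cube.coord j : Cube ι → Set.Icc (0 : ℝ) 1) := by
  unfold Cube.coord
  fun_prop

theorem Cube.measurable_drop {d : ℕ} (j : Fin d) : Measurable (Cube.drop j) := by
  unfold Cube.drop
  fun_prop

/-- `d`-stochastic measures: probability measures on `[0,1]^d` all of whose univariate marginals
are Lebesgue measure on `[0,1]`. -/
def dStochastic (d : ℕ) : Set (ProbabilityMeasure (Cube (Fin d))) :=
  {μ | ∀ j : Fin d,
    (μ : Measure (Cube (Fin d))).map (Cube.coord j) = (volume : Measure (Set.Icc (0 : ℝ) 1))}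

/-- The `d`-stochastic measures all of whose `(d-1)`-dimensional marginals are Lebesgue
measure on `[0,1]^(d-1)`. -/
def uniformMarginals (d : ℕ) : Set (ProbabilityMeasure (Cube (Fin d))) :=
  {μ | μ ∈ dStochastic d ∧ ∀ j : Fin d,
    (μ : Measure (Cube (Fin d))).map (Cube.drop j)
      = Cube.lebesgue {i : Fin d // i ≠ j}}

/-- The Hutchinson (Kantorovich–Rubinstein, Wasserstein-1) distance. On a compact space the
set below is bounded, so that `sSup` is a genuine supremum. -/
noncomputable def hutchinson {Ω : Type*} [MetricSpace Ω] [MeasurableSpace Ω]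
    (μ ν : ProbabilityMeasure Ω) : ℝ :=
  sSup {r : ℝ | ∃ g : Ω → ℝ, LipschitzWith 1 g ∧
    r = ∫ x, g x ∂(μ : Measure Ω) - ∫ x, g x ∂(ν : Measure Ω)}

/-- `F` is a dense subset of `P`, with respect to the Hutchinson distance. -/
def HutchinsonDense {Ω : Type*} [MetricSpace Ω] [MeasurableSpace Ω]
    (F P : Set (ProbabilityMeasure Ω)) : Prop :=
  F ⊆ P ∧ ∀ μ ∈ P, ∀ ε : ℝ, 0 < ε → ∃ ν ∈ F, hutchinson μ ν < ε

/-- The Hausdorff dimension of the (topological) support of a measure on the cube. -/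
noncomputable def supportDim {d : ℕ} (μ : ProbabilityMeasure (Cube (Fin d))) : ENNReal :=
  dimH (μ : Measure (Cube (Fin d))).support

/-! Write `d = n + 1`. It suffices to show, for each `s ∈ (0,1)`, that the measures with support of
dimension exactly `n + s` are dense. Two constructions give this.

A single measure: take a uniform point of the cube and change one coordinate so that the sum of all
coordinates modulo `1` follows a prescribed law `κ`. Any `n` coordinates of the result are still
independent and uniform (`map_sumLaw`), whatever `κ` is. For `κ` the natural measure on a symmetric
Cantor set of dimension `s`, the support lies in the set of points whose coordinate sum is in the
Cantor set modulo `1`. Counting covering cells bounds its dimension by `n + s`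
(`dimH_cantorSumSet_le`), and Fubini turns the Frostman bound of `κ` into one with exponent `n + s`
(`sumLaw_frostman`).

Density: cut the cube into `(M + 1)^d` cells and replace `μ` inside each cell by a scaled copy of
that measure carrying the same mass (`patch`). This keeps the uniform marginals, the Frostman
exponent and the upper bound on the dimension, and moves mass by at most `d / (M + 1)`. The mass
distribution principle then makes the dimension exactly `n + s`. -/

/-! ### Frostman bounds and Hausdorff dimension. -/

/-- A measure satisfies a Frostman bound with exponent `t` if the mass of every measurable set of
diameter at most `r` is at most a constant multiple of `r ^ t`. -/
def HasFrostmanBound {X : Type*} [MetricSpace X] [MeasurableSpace X] (ν : Measure X)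
    (t : ℝ) : Prop :=
  ∃ K : ℝ, 0 < K ∧ ∀ r : ℝ, 0 < r → ∀ A : Set X, MeasurableSet A →
    (∀ x ∈ A, ∀ y ∈ A, dist x y ≤ r) → ν A ≤ ENNReal.ofReal (K * r ^ t)

/-- The mass distribution principle. -/
theorem HasFrostmanBound.le_dimH {X : Type*} [MetricSpace X] [MeasurableSpace X] [BorelSpace X]
    {ν : Measure X} {t : ℝ} (ht : 0 < t) (hν : HasFrostmanBound ν t) {S : Set X}
    (hS : ν S ≠ 0) : ENNReal.ofReal t ≤ dimH S := by
  obtain ⟨K, hK, h⟩ := hν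
  have hK0 : ENNReal.ofReal K ≠ 0 := by simpa using hK
  have key : (ENNReal.ofReal K)⁻¹ • ν ≤ Measure.hausdorffMeasure t := by
    refine Measure.le_hausdorffMeasure t _ 1 one_pos fun s hs => ?_
    have hfin : Metric.ediam s ≠ ⊤ := (hs.trans_lt ENNReal.one_lt_top).ne
    -- The set `s` need not be measurable; its closure is, and has the same diameter.
    have hdist : ∀ x ∈ closure s, ∀ y ∈ closure s, dist x y ≤ (Metric.ediam s).toReal := by
      intro x hx y hy
      rw [dist_edist]
      refine ENNReal.toReal_mono hfin ?_
      rw [← Metric.ediam_closure]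
      exact Metric.edist_le_ediam_of_mem hx hy
    have hle : ν s ≤ ENNReal.ofReal (K * (Metric.ediam s).toReal ^ t) := by
      refine (measure_mono subset_closure).trans ?_
      -- The Frostman bound covers only `r > 0`, so diameter zero is reached by letting `r` tend to
      -- `0`; this uses `0 < t`.
      rcases eq_or_lt_of_le (ENNReal.toReal_nonneg (a := Metric.ediam s)) with h0 | h0
      · have hlim : Filter.Tendsto (fun r : ℝ => ENNReal.ofReal (K * r ^ t))
            (nhdsWithin 0 (Set.Ioi 0)) (nhds (ENNReal.ofReal (K * 0 ^ t))) := by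
          refine ENNReal.tendsto_ofReal (Filter.Tendsto.const_mul _ ?_)
          exact ((Real.continuousAt_rpow_const 0 t (Or.inr ht.le)).tendsto).mono_left
            nhdsWithin_le_nhds
        rw [← h0]
        refine ge_of_tendsto hlim ?_
        filter_upwards [self_mem_nhdsWithin] with r hr
        exact h r hr _ isClosed_closure.measurableSet
          fun x hx y hy => (hdist x hx y hy).trans (h0 ▸ le_of_lt hr)
      · exact h _ h0 _ isClosed_closure.measurableSet hdist
    rw [Measure.smul_apply, smul_eq_mul]
    calc (ENNReal.ofReal K)⁻¹ * ν s
        ≤ (ENNReal.ofReal K)⁻¹ * (ENNReal.ofReal K * Metric.ediam s ^ t) := by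
          gcongr
          refine hle.trans_eq ?_
          rw [ENNReal.ofReal_mul hK.le, ← ENNReal.ofReal_rpow_of_nonneg ENNReal.toReal_nonneg ht.le,
            ENNReal.ofReal_toReal hfin]
      _ = Metric.ediam s ^ t := by
          rw [← mul_assoc, ENNReal.inv_mul_cancel hK0 ENNReal.ofReal_ne_top, one_mul]
  have hne : Measure.hausdorffMeasure (t.toNNReal : ℝ) S ≠ 0 := by
    rw [Real.coe_toNNReal _ ht.le]
    intro h0
    have := key S
    rw [h0, Measure.smul_apply, smul_eq_mul, nonpos_iff_eq_zero, mul_eq_zero] at this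
    rcases this with h1 | h1
    · exact ENNReal.ofReal_ne_top (ENNReal.inv_eq_zero.1 h1)
    · exact hS h1
  exact le_dimH_of_hausdorffMeasure_ne_zero hne

/-! ### Coordinates and compactness of the cube. -/

namespace Cube

variable {ι : Type*} [Fintype ι]

theorem abs_sub_le_dist (x y : Cube ι) (i : ι) : |x.1 i - y.1 i| ≤ dist x y := by
  have := PiLp.norm_apply_le (x.1 - y.1) i
  rwa [PiLp.sub_apply, Real.norm_eq_abs, ← dist_eq_norm] at this

theorem dist_le_sum (x y : Cube ι) : dist x y ≤ ∑ i, |x.1 i - y.1 i| := by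
  have h : dist x y = √(∑ i, dist (x.1 i) (y.1 i) ^ 2) := EuclideanSpace.dist_eq x.1 y.1
  rw [h]
  refine Real.sqrt_le_iff.2 ⟨by positivity, ?_⟩
  simp only [Real.dist_eq]
  exact Finset.sum_sq_le_sq_sum_of_nonneg fun _ _ => abs_nonneg _

theorem dist_le_card_mul (x y : Cube ι) {r : ℝ} (h : ∀ i, |x.1 i - y.1 i| ≤ r) :
    dist x y ≤ Fintype.card ι * r := by
  refine (dist_le_sum x y).trans ?_
  refine (Finset.sum_le_sum fun i _ => h i).trans_eq ?_
  simp

/-- The coordinates of a point of the cube. -/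
def toFun (x : Cube ι) : ι → ℝ := fun i => x.1 i

theorem measurableSet_cube :
    MeasurableSet {x : EuclideanSpace ℝ ι | ∀ i, x i ∈ Set.Icc (0 : ℝ) 1} := by
  have : {x : EuclideanSpace ℝ ι | ∀ i, x i ∈ Set.Icc (0 : ℝ) 1}
      = ⋂ i, {x : EuclideanSpace ℝ ι | x i ∈ Set.Icc (0 : ℝ) 1} := by
    ext; simp
  rw [this]
  exact MeasurableSet.iInter fun i => measurableSet_Icc.preimage (by fun_prop)

theorem measurableEmbedding_toFun : MeasurableEmbedding (toFun : Cube ι → ι → ℝ) :=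
  ((MeasurableEquiv.toLp 2 (ι → ℝ)).symm.measurableEmbedding).comp
    (MeasurableEmbedding.subtype_coe measurableSet_cube)

theorem range_toFun : Set.range (toFun : Cube ι → ι → ℝ) = Set.univ.pi fun _ => Set.Icc 0 1 := by
  ext f
  constructor
  · rintro ⟨x, rfl⟩ i _
    exact x.2 i
  · intro h
    exact ⟨⟨WithLp.toLp 2 f, fun i => h i (Set.mem_univ i)⟩, rfl⟩

/-- The point of the cube with given coordinates. -/
def ofFun (f : ι → Set.Icc (0 : ℝ) 1) : Cube ι :=
  ⟨WithLp.toLp 2 fun i => (f i : ℝ), fun i => (f i).2⟩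

theorem continuous_ofFun : Continuous (ofFun : (ι → Set.Icc (0 : ℝ) 1) → Cube ι) := by
  unfold ofFun
  fun_prop

instance : CompactSpace (Cube ι) where
  isCompact_univ := by
    have : Set.range (ofFun : (ι → Set.Icc (0 : ℝ) 1) → Cube ι) = Set.univ :=
      Set.range_eq_univ.2 fun x => ⟨fun i => ⟨x.1 i, x.2 i⟩, rfl⟩
    rw [← this]
    exact isCompact_range continuous_ofFun

end Cube

/-! ### Uniform marginals as product measures. -/

/-- The uniform distribution on `[0,1]`, as a measure on `ℝ`. -/
noncomputable def unitUniform : Measure ℝ := volume.restrict (Set.Icc 0 1)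

instance : IsProbabilityMeasure unitUniform := ⟨by simp [unitUniform]⟩

theorem unitUniform_eq_Ioc : unitUniform = volume.restrict (Set.Ioc (0 : ℝ) 1) :=
  Measure.restrict_congr_set Ioc_ae_eq_Icc.symm

theorem unitUniform_eq_Ico : unitUniform = volume.restrict (Set.Ico (0 : ℝ) 1) :=
  Measure.restrict_congr_set Ico_ae_eq_Icc.symm

theorem Cube.map_toFun_lebesgue {ι : Type*} [Fintype ι] :
    (Cube.lebesgue ι).map Cube.toFun = Measure.pi fun _ => unitUniform := by
  unfold unitUniform
  rw [← Measure.restrict_pi_pi, ← Cube.range_toFun, ← volume_pi,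
    ← Cube.measurableEmbedding_toFun.map_comap]
  congr 1
  ext s hs
  rw [Cube.measurableEmbedding_toFun.comap_apply, Cube.lebesgue,
    MeasurableEmbedding.comap_apply]
  · rw [← (EuclideanSpace.volume_preserving_symm_measurableEquiv_toLp ι).symm.measure_preimage_equiv]
    congr 1
    ext f
    constructor
    · rintro ⟨x, hx, h⟩
      exact ⟨x, hx, funext fun i => congrArg (fun z => z.ofLp i) h⟩
    · rintro ⟨x, hx, h⟩
      exact ⟨x, hx, by ext i; exact congrFun h i⟩
  · exact MeasurableEmbedding.subtype_coe Cube.measurableSet_cube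

theorem MeasurableEmbedding.map_inj {α β : Type*} [MeasurableSpace α] [MeasurableSpace β]
    {f : α → β} (hf : MeasurableEmbedding f) {μ ν : Measure α} (h : μ.map f = ν.map f) :
    μ = ν := by
  rw [← hf.comap_map μ, h, hf.comap_map]

/-- The univariate condition is automatic: coordinate `j` survives when some `k ≠ j` is dropped,
which is where `2 ≤ d` enters. -/
theorem mem_uniformMarginals_of_pi {d : ℕ} (hd : 2 ≤ d) {μ : ProbabilityMeasure (Cube (Fin d))}
    (h : ∀ j : Fin d, (μ : Measure (Cube (Fin d))).map
      (fun x (i : {i : Fin d // i ≠ j}) => x.1 i.1) = Measure.pi fun _ => unitUniform) :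
    μ ∈ uniformMarginals d := by
  constructor
  · intro j
    obtain ⟨k, hk⟩ : ∃ k : Fin d, j ≠ k := by
      have : Nontrivial (Fin d) := Fin.nontrivial_iff_two_le.2 hd
      exact (exists_ne j).imp fun _ => Ne.symm
    refine (MeasurableEmbedding.subtype_coe (measurableSet_Icc (a := (0 : ℝ)) (b := 1))).map_inj ?_
    rw [Measure.map_map measurable_subtype_coe (Cube.measurable_coord j)]
    have hv : (volume : Measure (Set.Icc (0 : ℝ) 1)).map Subtype.val = unitUniform := by
      rw [Measure.Subtype.volume_def, map_comap_subtype_coe measurableSet_Icc]; rfl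
    have := congrArg (Measure.map fun f => f ⟨j, hk⟩) (h k)
    rw [(measurePreserving_eval (fun _ : {i : Fin d // i ≠ k} => unitUniform) ⟨j, hk⟩).map_eq,
      Measure.map_map (by fun_prop) (by fun_prop)] at this
    exact this.trans hv.symm
  · intro j
    refine Cube.measurableEmbedding_toFun.map_inj ?_
    rw [Cube.map_toFun_lebesgue, ← h j,
      Measure.map_map Cube.measurableEmbedding_toFun.measurable (Cube.measurable_drop j)]
    rfl

theorem map_drop_of_mem_uniformMarginals {d : ℕ} {μ : ProbabilityMeasure (Cube (Fin d))}
    (h : μ ∈ uniformMarginals d) (j : Fin d) :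
    MeasurePreserving (fun (x : Cube (Fin d)) (i : {i : Fin d // i ≠ j}) => x.1 i.1)
      (μ : Measure (Cube (Fin d))) (Measure.pi fun _ => unitUniform) := by
  refine ⟨by fun_prop, ?_⟩
  rw [← Cube.map_toFun_lebesgue, ← h.2 j,
    Measure.map_map Cube.measurableEmbedding_toFun.measurable (Cube.measurable_drop j)]
  rfl

/-- On the circle `ℝ/ℤ` this is a reflection followed by a rotation, which preserves Haar measure.
-/
theorem measurePreserving_fract_sub (a : ℝ) :
    MeasurePreserving (fun x : ℝ => Int.fract (a - x)) unitUniform unitUniform := by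
  have hF : Measurable fun y : UnitAddCircle => (AddCircle.equivIco 1 0 y : ℝ) :=
    measurable_subtype_coe.comp (AddCircle.measurableEquivIco (1 : ℝ) 0).measurable
  have hmk : MeasurePreserving (QuotientAddGroup.mk : ℝ → UnitAddCircle) unitUniform volume := by
    have := UnitAddCircle.measurePreserving_mk 0
    rwa [zero_add, ← unitUniform_eq_Ioc] at this
  have hval : ∀ x : ℝ, (AddCircle.equivIco 1 0 (x : UnitAddCircle) : ℝ) = Int.fract x := by
    intro x
    rw [AddCircle.coe_equivIco_mk_apply]; simp
  have h1 : MeasurePreserving (fun y : UnitAddCircle => (AddCircle.equivIco 1 0 y : ℝ))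
      volume unitUniform := by
    refine ⟨hF, ?_⟩
    rw [← hmk.map_eq, Measure.map_map hF hmk.measurable]
    have : (fun y : UnitAddCircle => (AddCircle.equivIco 1 0 y : ℝ)) ∘ QuotientAddGroup.mk
        =ᵐ[unitUniform] id := by
      rw [unitUniform_eq_Ico]
      filter_upwards [ae_restrict_mem measurableSet_Ico] with x hx
      exact (hval x).trans (Int.fract_eq_self.2 hx)
    rw [Measure.map_congr this, Measure.map_id]
  have h2 := h1.comp ((Measure.measurePreserving_sub_left volume (a : UnitAddCircle)).comp hmk)
  convert h2 using 2 with x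
  exact (hval (a - x)).symm

/-! ### The Cantor measure and its Frostman bound. -/

/-- The point of the symmetric Cantor set of contraction ratio `ρ` with a given address. -/
noncomputable def cantorPoint (ρ : ℝ) (ω : ℕ → Bool) : ℝ :=
  (1 - ρ) * ∑' i, (if ω i then 1 else 0) * ρ ^ i

/-- A fair coin. -/
noncomputable def fairCoin : Measure Bool := (PMF.uniformOfFintype Bool).toMeasure

instance : IsProbabilityMeasure fairCoin := by unfold fairCoin; infer_instance

theorem fairCoin_singleton (b : Bool) : fairCoin {b} = 2⁻¹ := by
  rw [fairCoin, PMF.toMeasure_apply_singleton _ _ (measurableSet_singleton b)]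
  simp

/-- The natural self-similar measure on the symmetric Cantor set of contraction ratio `ρ`. -/
noncomputable def cantorMeasure (ρ : ℝ) : Measure ℝ :=
  (Measure.infinitePi fun _ : ℕ => fairCoin).map (cantorPoint ρ)

section

variable {ρ : ℝ} (h0 : 0 < ρ) (h1 : ρ < 1)
include h0 h1

theorem summable_cantorPoint (ω : ℕ → Bool) :
    Summable fun i => (if ω i then 1 else 0) * ρ ^ i := by
  refine Summable.of_nonneg_of_le (fun i => by positivity) (fun i => ?_)
    (summable_geometric_of_lt_one h0.le h1)
  have := pow_pos h0 i
  split_ifs <;> simp [this.le]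

theorem cantorPoint_mem_Icc (ω : ℕ → Bool) : cantorPoint ρ ω ∈ Set.Icc (0 : ℝ) 1 := by
  have hρ : 0 < 1 - ρ := by linarith
  refine ⟨mul_nonneg hρ.le (tsum_nonneg fun i => by positivity), ?_⟩
  have : ∑' i, (if ω i then 1 else 0) * ρ ^ i ≤ ∑' i, ρ ^ i := by
    refine (summable_cantorPoint h0 h1 ω).tsum_le_tsum (fun i => ?_)
      (summable_geometric_of_lt_one h0.le h1)
    have := pow_pos h0 i
    split_ifs <;> simp [this.le]
  rw [tsum_geometric_of_lt_one h0.le h1] at this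
  calc cantorPoint ρ ω ≤ (1 - ρ) * (1 - ρ)⁻¹ := mul_le_mul_of_nonneg_left this hρ.le
    _ = 1 := mul_inv_cancel₀ hρ.ne'

theorem continuous_cantorPoint : Continuous (cantorPoint ρ) := by
  refine continuous_const.mul (continuous_tsum (fun i => ?_)
    (summable_geometric_of_lt_one h0.le h1) fun i ω => ?_)
  · have h : Continuous fun b : Bool => if b then (1 : ℝ) else 0 := continuous_of_discreteTopology
    exact (h.comp (continuous_apply i)).mul continuous_const
  · have := pow_pos h0 i
    split_ifs <;> simp [abs_of_pos h0, this.le]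

theorem cantorPoint_eq_sum_add (ω : ℕ → Bool) (k : ℕ) :
    cantorPoint ρ ω = (1 - ρ) * ∑ i ∈ Finset.range k, (if ω i then 1 else 0) * ρ ^ i
      + ρ ^ k * cantorPoint ρ fun i => ω (i + k) := by
  unfold cantorPoint
  rw [← (summable_cantorPoint h0 h1 ω).sum_add_tsum_nat_add k, mul_add, mul_left_comm (ρ ^ k)]
  congr 2
  rw [← tsum_mul_left]
  exact tsum_congr fun i => by ring

theorem cantorPoint_sub_of_agree {ω ω' : ℕ → Bool} {k : ℕ} (h : ∀ i < k, ω i = ω' i) :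
    cantorPoint ρ ω - cantorPoint ρ ω'
      = ρ ^ k * (cantorPoint ρ (fun i => ω (i + k)) - cantorPoint ρ fun i => ω' (i + k)) := by
  rw [cantorPoint_eq_sum_add h0 h1 ω k, cantorPoint_eq_sum_add h0 h1 ω' k,
    Finset.sum_congr rfl fun i hi => by rw [h i (Finset.mem_range.1 hi)]]
  ring

theorem abs_cantorPoint_sub_le {ω ω' : ℕ → Bool} {k : ℕ} (h : ∀ i < k, ω i = ω' i) :
    |cantorPoint ρ ω - cantorPoint ρ ω'| ≤ ρ ^ k := by
  have hk := pow_pos h0 k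
  rw [cantorPoint_sub_of_agree h0 h1 h, abs_mul, abs_of_pos hk]
  refine mul_le_of_le_one_right hk.le ?_
  have ha := cantorPoint_mem_Icc h0 h1 fun i => ω (i + k)
  have hb := cantorPoint_mem_Icc h0 h1 fun i => ω' (i + k)
  rw [abs_le]
  constructor <;> linarith [ha.1, ha.2, hb.1, hb.2]

/-- The first letter decides between the pieces in `[0, ρ]` and `[1 - ρ, 1]`, which are `1 - 2ρ`
apart. -/
theorem le_abs_cantorPoint_sub {ω ω' : ℕ → Bool} (h : ω 0 ≠ ω' 0) :
    1 - 2 * ρ ≤ |cantorPoint ρ ω - cantorPoint ρ ω'| := by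
  have ha := cantorPoint_mem_Icc h0 h1 fun i => ω (i + 1)
  have hb := cantorPoint_mem_Icc h0 h1 fun i => ω' (i + 1)
  have hab : |cantorPoint ρ (fun i => ω (i + 1)) - cantorPoint ρ fun i => ω' (i + 1)| ≤ 1 := by
    rw [abs_le]
    constructor <;> linarith [ha.1, ha.2, hb.1, hb.2]
  rw [abs_le] at hab
  rw [cantorPoint_eq_sum_add h0 h1 ω 1, cantorPoint_eq_sum_add h0 h1 ω' 1, le_abs]
  simp only [Finset.range_one, Finset.sum_singleton, pow_zero, pow_one, mul_one]
  rcases hω : ω 0 <;> rcases hω' : ω' 0 <;> simp_all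
  · right; nlinarith
  · left; nlinarith

/-- At the first disagreement `i < k`, the gap `1 - 2ρ` appears scaled by `ρ ^ i > ρ ^ k`. -/
theorem agree_of_abs_cantorPoint_sub_le (h2 : 2 * ρ < 1) {ω ω' : ℕ → Bool} {k : ℕ}
    (h : |cantorPoint ρ ω - cantorPoint ρ ω'| ≤ (1 - 2 * ρ) * ρ ^ k) : ∀ i < k, ω i = ω' i := by
  by_contra! hne
  classical
  obtain ⟨hik, hi⟩ := Nat.find_spec hne
  set i := Nat.find hne
  have hmin : ∀ j < i, ω j = ω' j := fun j hj => by
    by_contra hj'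
    exact Nat.find_min hne hj ⟨hj.trans hik, hj'⟩
  have hi0 := pow_pos h0 i
  rw [cantorPoint_sub_of_agree h0 h1 hmin, abs_mul, abs_of_pos hi0, mul_comm] at h
  have h3 : 1 - 2 * ρ ≤ _ := le_abs_cantorPoint_sub h0 h1 (ω := fun j => ω (j + i))
    (ω' := fun j => ω' (j + i)) (by simpa using hi)
  have h4 : ρ ^ k < ρ ^ i := pow_lt_pow_right_of_lt_one₀ h0 h1 hik
  have h5 := mul_le_mul_of_nonneg_right h3 hi0.le
  have h6 := mul_lt_mul_of_pos_left h4 (by linarith : 0 < 1 - 2 * ρ)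
  linarith

theorem isProbabilityMeasure_cantorMeasure : IsProbabilityMeasure (cantorMeasure ρ) :=
  Measure.isProbabilityMeasure_map (continuous_cantorPoint h0 h1).measurable.aemeasurable

/-- If `ρ ^ (n + 1) < r / (1 - 2ρ) ≤ ρ ^ n`, all addresses of points of `A` share their first `n`
letters, an event of probability `2⁻ⁿ = (ρ ^ n) ^ s`. The factor `2` in the constant pays for
passing from `n` to `n + 1`. -/
theorem cantorMeasure_frostman (h2 : 2 * ρ < 1) {s : ℝ} (hs : 0 < s) (hρs : ρ ^ s = 1 / 2) :
    HasFrostmanBound (cantorMeasure ρ) s := by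
  have hc : 0 < 1 - 2 * ρ := by linarith
  have := isProbabilityMeasure_cantorMeasure h0 h1
  refine ⟨2 * (1 - 2 * ρ)⁻¹ ^ s, by positivity, fun r hr A hA hAr => ?_⟩
  rw [mul_assoc, ← Real.mul_rpow (by positivity) hr.le, inv_mul_eq_div]
  rcases le_or_gt 1 (r / (1 - 2 * ρ)) with hr1 | hr1
  · refine prob_le_one.trans ?_
    rw [ENNReal.one_le_ofReal]
    have := Real.one_le_rpow hr1 hs.le
    linarith
  obtain ⟨n, hn, hn'⟩ := exists_nat_pow_near_of_lt_one (div_pos hr hc) hr1.le h0 h1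
  rw [div_le_iff₀ hc, mul_comm] at hn'
  rw [cantorMeasure, Measure.map_apply (continuous_cantorPoint h0 h1).measurable hA]
  rcases (cantorPoint ρ ⁻¹' A).eq_empty_or_nonempty with he | ⟨ω₀, hω₀⟩
  · simp [he]
  have hsub : cantorPoint ρ ⁻¹' A ⊆ Set.pi (Finset.range n) fun i => {ω₀ i} := by
    intro ω hω i hi
    refine agree_of_abs_cantorPoint_sub_le h0 h1 h2 ?_ i (by simpa using hi)
    exact (hAr _ hω _ hω₀).trans hn'
  refine (measure_mono hsub).trans ?_
  rw [Measure.infinitePi_pi _ (fun i _ => measurableSet_singleton _)]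
  simp only [fairCoin_singleton, Finset.prod_const, Finset.card_range]
  have hpow : (ρ ^ (n + 1)) ^ s = (1 / 2) * (1 / 2 : ℝ) ^ n := by
    rw [← Real.rpow_natCast, ← Real.rpow_mul h0.le, mul_comm, Real.rpow_mul h0.le, hρs,
      Real.rpow_natCast, pow_succ']
  have hle : (1 / 2 : ℝ) ^ n ≤ 2 * (r / (1 - 2 * ρ)) ^ s := by
    have := Real.rpow_le_rpow (by positivity) hn.le hs.le
    rw [hpow] at this
    linarith
  have hhalf : (2⁻¹ : ENNReal) = ENNReal.ofReal (1 / 2) := by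
    rw [one_div, ENNReal.ofReal_inv_of_pos two_pos]; simp
  rw [hhalf, ← ENNReal.ofReal_pow (by norm_num)]
  exact ENNReal.ofReal_le_ofReal hle

end

/-! ### Measures with prescribed law of the coordinate sum modulo 1. -/

instance {ι : Type*} [Fintype ι] : IsProbabilityMeasure (Cube.lebesgue ι) := by
  refine ⟨?_⟩
  have : ((Cube.lebesgue ι).map Cube.toFun) Set.univ = 1 := by
    rw [Cube.map_toFun_lebesgue]; exact measure_univ
  rwa [Measure.map_apply Cube.measurableEmbedding_toFun.measurable MeasurableSet.univ] at this

theorem measurePreserving_toFun_lebesgue (ι : Type*) [Fintype ι] :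
    MeasurePreserving Cube.toFun (Cube.lebesgue ι) (Measure.pi fun _ => unitUniform) :=
  ⟨Cube.measurableEmbedding_toFun.measurable, Cube.map_toFun_lebesgue⟩

section

variable {n : ℕ} (l : Fin (n + 1))

/-- Given the other coordinates, coordinate `l` undergoes a reflection and rotation of the circle,
so this is a measure-preserving skew product. -/
theorem measurePreserving_update_fract {G : (Fin n → ℝ) → ℝ} (hG : Measurable G) :
    MeasurePreserving (fun x : Fin (n + 1) → ℝ =>
      Function.update x l (Int.fract (G (l.removeNth x) - x l)))
      (Measure.pi fun _ => unitUniform) (Measure.pi fun _ => unitUniform) := by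
  have he := measurePreserving_piFinSuccAbove (fun _ : Fin (n + 1) => unitUniform) l
  have hskew : MeasurePreserving (fun p : (Fin n → ℝ) × ℝ => (p.1, Int.fract (G p.1 - p.2)))
      ((Measure.pi fun _ => unitUniform).prod unitUniform)
      ((Measure.pi fun _ => unitUniform).prod unitUniform) :=
    (MeasurePreserving.id _).skew_product (g := fun w t => Int.fract (G w - t))
      (((hG.comp measurable_fst).sub measurable_snd).fract)
      (Filter.Eventually.of_forall fun w => (measurePreserving_fract_sub (G w)).map_eq)
  have := he.symm.comp (Measure.measurePreserving_swap.comp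
    (hskew.comp (Measure.measurePreserving_swap.comp he)))
  convert this using 2 with x
  exact (Fin.insertNth_removeNth l _ x).symm

/-- Replace the coordinate `l` of `x` so that the sum of the coordinates is `c` modulo `1`. -/
noncomputable def adjustCoord (x : Cube (Fin (n + 1))) (c : ℝ) : Cube (Fin (n + 1)) :=
  ⟨WithLp.toLp 2 (Function.update x.1 l (Int.fract (c - (∑ i, x.1 i - x.1 l)))), fun i => by
    rcases eq_or_ne i l with rfl | h
    · rw [PiLp.toLp_apply, Function.update_self]
      exact ⟨Int.fract_nonneg _, (Int.fract_lt_one _).le⟩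
    · simpa [h] using x.2 i⟩

theorem adjustCoord_self (x : Cube (Fin (n + 1))) (c : ℝ) :
    (adjustCoord l x c).1 l = Int.fract (c - (∑ i, x.1 i - x.1 l)) := by
  simp [adjustCoord]

theorem adjustCoord_of_ne (x : Cube (Fin (n + 1))) (c : ℝ) {i : Fin (n + 1)} (h : i ≠ l) :
    (adjustCoord l x c).1 i = x.1 i := by
  simp [adjustCoord, h]

theorem measurable_adjustCoord :
    Measurable fun p : Cube (Fin (n + 1)) × ℝ => adjustCoord l p.1 p.2 := by
  refine Measurable.subtype_mk ?_
  refine (WithLp.measurable_toLp 2 _).comp (measurable_pi_iff.2 fun i => ?_)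
  rcases eq_or_ne i l with rfl | h
  · simp only [Function.update_self]
    fun_prop
  · simp only [Function.update_of_ne h]
    fun_prop

/-- Dropping `l` leaves coordinates that were never changed. Dropping `j ≠ l` frees `x j` to serve
as the randomness of the new coordinate `l`; the old `x l` plays no role. -/
theorem measurePreserving_adjustCoord (c : ℝ) (j : Fin (n + 1)) :
    MeasurePreserving (fun (x : Cube (Fin (n + 1))) (i : {i // i ≠ j}) => (adjustCoord l x c).1 i)
      (Cube.lebesgue (Fin (n + 1))) (Measure.pi fun _ => unitUniform) := by
  have hr : MeasurePreserving (fun (y : Fin (n + 1) → ℝ) (i : {i // i ≠ j}) => y i)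
      (Measure.pi fun _ => unitUniform) (Measure.pi fun _ => unitUniform) :=
    measurePreserving_fst.comp
      (measurePreserving_piEquivPiSubtypeProd (fun _ : Fin (n + 1) => unitUniform) (· ≠ j))
  rcases eq_or_ne j l with rfl | hjl
  · convert hr.comp (measurePreserving_toFun_lebesgue _) using 2 with x
    funext i
    exact adjustCoord_of_ne _ _ _ i.2
  · obtain ⟨j', hj'⟩ := Fin.exists_succAbove_eq hjl
    -- Swapping `l` and `j` puts `x j` in the slot to be updated. The summand `+ w j'` in `G` below
    -- cancels the old `x l`, which now sits at position `j`.
    have hsw : MeasurePreserving (fun (y : Fin (n + 1) → ℝ) i => y (Equiv.swap l j i))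
        (Measure.pi fun _ => unitUniform) (Measure.pi fun _ => unitUniform) :=
      measurePreserving_arrowCongr' (fun _ => unitUniform) (fun _ => unitUniform)
        (Equiv.swap l j) (MeasurableEquiv.refl ℝ) fun _ => MeasurePreserving.id _
    have hS := measurePreserving_update_fract l (G := fun w => c - ∑ k, w k + w j')
      (by fun_prop)
    convert hr.comp (hS.comp (hsw.comp (measurePreserving_toFun_lebesgue _))) using 2 with x
    funext i
    rcases eq_or_ne i.1 l with hi | hi
    · simp only [Function.comp_apply, Function.update_self, hi, adjustCoord_self]
      have hsum : ∑ i, x.1 i = ∑ i, x.1 (Equiv.swap l j i) :=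
        (Equiv.sum_comp (Equiv.swap l j) x.1).symm
      rw [hsum, Fin.sum_univ_succAbove _ l]
      simp only [Fin.removeNth, hj', Equiv.swap_apply_left, Equiv.swap_apply_right, Cube.toFun]
      congr 1
      ring
    · simp only [Function.comp_apply, Function.update_of_ne hi, adjustCoord_of_ne _ _ _ hi]
      rw [Equiv.swap_apply_of_ne_of_ne hi i.2]
      rfl

/-- The law of a uniform point of the cube after its coordinate `l` has been adjusted in such a
way that the sum of the coordinates modulo `1` has law `κ`. -/
noncomputable def sumLaw (κ : Measure ℝ) : Measure (Cube (Fin (n + 1))) :=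
  ((Cube.lebesgue (Fin (n + 1))).prod κ).map fun p => adjustCoord l p.1 p.2

instance (κ : Measure ℝ) [IsProbabilityMeasure κ] : IsProbabilityMeasure (sumLaw l κ) :=
  Measure.isProbabilityMeasure_map (measurable_adjustCoord l).aemeasurable

/-- The marginal is uniform for each fixed target sum `c`, hence also after averaging over `κ`. -/
theorem map_sumLaw (κ : Measure ℝ) [IsProbabilityMeasure κ] (j : Fin (n + 1)) :
    (sumLaw l κ).map (fun x (i : {i : Fin (n + 1) // i ≠ j}) => x.1 i.1)
      = Measure.pi fun _ => unitUniform := by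
  have hm : Measurable fun (x : Cube (Fin (n + 1))) (i : {i // i ≠ j}) => x.1 i.1 := by fun_prop
  rw [sumLaw, Measure.map_map hm (measurable_adjustCoord l)]
  have hskew := (MeasurePreserving.id κ).skew_product
    (g := fun c (x : Cube (Fin (n + 1))) (i : {i // i ≠ j}) => (adjustCoord l x c).1 i.1)
    (μc := Cube.lebesgue (Fin (n + 1))) (μd := Measure.pi fun _ => unitUniform)
    (hm.comp ((measurable_adjustCoord l).comp measurable_swap))
    (Filter.Eventually.of_forall fun c => (measurePreserving_adjustCoord l c j).map_eq)
  exact (measurePreserving_snd.comp (hskew.comp Measure.measurePreserving_swap)).map_eq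

/-- For fixed `x`, the new coordinate is a translate of `c` modulo `1`, so distances in `c` are
preserved wherever `⌊c - σ⌋` is constant. On `[0,1]` this floor takes at most two values, whence the
factor `2`. -/
theorem sumLaw_slice_le {κ : Measure ℝ} (hκ : κ (Set.Icc 0 1)ᶜ = 0) {M : ENNReal} {r : ℝ}
    (hM : ∀ D : Set ℝ, MeasurableSet D → (∀ x ∈ D, ∀ y ∈ D, dist x y ≤ r) → κ D ≤ M)
    {A : Set (Cube (Fin (n + 1)))} (hA : MeasurableSet A)
    (hAr : ∀ x ∈ A, ∀ y ∈ A, dist x y ≤ r) (x : Cube (Fin (n + 1))) :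
    κ {c | adjustCoord l x c ∈ A} ≤ 2 * M := by
  set σ := ∑ i, x.1 i - x.1 l
  have hmeas : Measurable fun c => adjustCoord l x c :=
    (measurable_adjustCoord l).comp (measurable_const.prodMk measurable_id)
  let D : ℤ → Set ℝ := fun m => {c | adjustCoord l x c ∈ A} ∩ {c | ⌊c - σ⌋ = m}
  have hD : ∀ m, κ (D m) ≤ M := by
    intro m
    refine hM _ ((hmeas hA).inter ?_) ?_
    · exact (measurable_id.sub_const σ).floor (measurableSet_singleton m)
    · rintro c ⟨hc, hcm⟩ c' ⟨hc', hcm'⟩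
      refine le_trans ?_ (hAr _ hc _ hc')
      refine le_trans (le_of_eq ?_) (Cube.abs_sub_le_dist _ _ l)
      rw [adjustCoord_self, adjustCoord_self, Int.fract, Int.fract, Real.dist_eq]
      simp only [Set.mem_ofPred_eq] at hcm hcm'
      rw [hcm, hcm']
      congr 1
      ring
  have hsub : {c | adjustCoord l x c ∈ A}
      ⊆ (D ⌊-σ⌋ ∪ D (⌊-σ⌋ + 1)) ∪ (Set.Icc 0 1)ᶜ := by
    intro c hc
    by_cases hI : c ∈ Set.Icc (0 : ℝ) 1
    · left
      have h1 : ⌊-σ⌋ ≤ ⌊c - σ⌋ := Int.floor_le_floor (by linarith [hI.1])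
      have h2 : ⌊c - σ⌋ ≤ ⌊-σ⌋ + 1 := by
        rw [← Int.floor_add_one]
        exact Int.floor_le_floor (by linarith [hI.2])
      rcases (by omega : ⌊c - σ⌋ = ⌊-σ⌋ ∨ ⌊c - σ⌋ = ⌊-σ⌋ + 1) with h | h
      · exact Or.inl ⟨hc, h⟩
      · exact Or.inr ⟨hc, h⟩
    · exact Or.inr hI
  calc κ {c | adjustCoord l x c ∈ A}
      ≤ κ (D ⌊-σ⌋ ∪ D (⌊-σ⌋ + 1)) + κ (Set.Icc 0 1)ᶜ :=
        (measure_mono hsub).trans (measure_union_le _ _)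
    _ ≤ (M + M) + 0 := by
        rw [hκ]
        gcongr
        exact (measure_union_le _ _).trans (add_le_add (hD _) (hD _))
    _ = 2 * M := by rw [add_zero, two_mul]

theorem unitUniform_closedBall_le (a : ℝ) {r : ℝ} :
    unitUniform (Metric.closedBall a r) ≤ ENNReal.ofReal (2 * r) :=
  (Measure.restrict_apply_le _ _).trans_eq (Real.volume_closedBall a r)

theorem lebesgue_slab_le (a : Cube (Fin (n + 1))) {r : ℝ} (hr : 0 < r) :
    Cube.lebesgue (Fin (n + 1)) {x | ∀ i, i ≠ l → |x.1 i - a.1 i| ≤ r}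
      ≤ ENNReal.ofReal ((2 * r) ^ n) := by
  have h : {x : Cube (Fin (n + 1)) | ∀ i, i ≠ l → |x.1 i - a.1 i| ≤ r} = Cube.toFun ⁻¹'
      Set.univ.pi fun i => if i = l then Set.univ else Metric.closedBall (a.1 i) r := by
    ext x
    simp only [Set.mem_ofPred_eq, Set.mem_preimage, Set.mem_univ_pi]
    refine forall_congr' fun i => ?_
    split_ifs with hi <;> simp [hi, Cube.toFun, Real.dist_eq]
  rw [h, (measurePreserving_toFun_lebesgue _).measure_preimage, Measure.pi_pi,
    Fin.prod_univ_succAbove _ l]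
  · simp only [if_true, measure_univ, one_mul, Fin.succAbove_ne, if_false]
    rw [ENNReal.ofReal_pow (by positivity)]
    refine (Finset.prod_le_prod' fun i _ => unitUniform_closedBall_le _).trans_eq ?_
    simp
  · refine (MeasurableSet.univ_pi fun i => ?_).nullMeasurableSet
    split_ifs
    · exact MeasurableSet.univ
    · exact measurableSet_closedBall

/-- Fubini: the unchanged `n` coordinates must lie within `r` of those of a point of `A`, which
costs `(2r) ^ n`, and each slice in `c` costs at most `2K r ^ s`. -/
theorem sumLaw_frostman {κ : Measure ℝ} [IsProbabilityMeasure κ] (hκ : κ (Set.Icc 0 1)ᶜ = 0)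
    {s : ℝ} (h : HasFrostmanBound κ s) : HasFrostmanBound (sumLaw l κ) (n + s) := by
  obtain ⟨K, hK, h⟩ := h
  refine ⟨2 * K * 2 ^ n, by positivity, fun r hr A hA hAr => ?_⟩
  rcases A.eq_empty_or_nonempty with rfl | ⟨a, ha⟩
  · simp
  rw [sumLaw, Measure.map_apply (measurable_adjustCoord l) hA,
    Measure.prod_apply (measurable_adjustCoord l hA)]
  set B := {x : Cube (Fin (n + 1)) | ∀ i, i ≠ l → |x.1 i - a.1 i| ≤ r}
  have hB : MeasurableSet B := by
    have : B = ⋂ i, ⋂ _ : i ≠ l, {x : Cube (Fin (n + 1)) | |x.1 i - a.1 i| ≤ r} := by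
      ext; simp [B]
    rw [this]
    exact MeasurableSet.iInter fun i => MeasurableSet.iInter fun _ =>
      measurableSet_le (by fun_prop) measurable_const
  calc ∫⁻ x, κ (Prod.mk x ⁻¹' ((fun p => adjustCoord l p.1 p.2) ⁻¹' A))
          ∂Cube.lebesgue (Fin (n + 1))
      ≤ ∫⁻ x, B.indicator (fun _ => 2 * ENNReal.ofReal (K * r ^ s)) x
          ∂Cube.lebesgue (Fin (n + 1)) := by
        refine lintegral_mono fun x => ?_
        by_cases hx : x ∈ B
        · rw [Set.indicator_of_mem hx]
          exact sumLaw_slice_le l hκ (h r hr) hA hAr x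
        · rw [Set.indicator_of_notMem hx, nonpos_iff_eq_zero]
          convert measure_empty (μ := κ)
          refine Set.eq_empty_of_forall_notMem fun c hc => hx fun i hi => ?_
          have := (Cube.abs_sub_le_dist (adjustCoord l x c) a i).trans (hAr _ hc _ ha)
          rwa [adjustCoord_of_ne _ _ _ hi] at this
    _ = 2 * ENNReal.ofReal (K * r ^ s) * Cube.lebesgue (Fin (n + 1)) B :=
        lintegral_indicator_const hB _
    _ ≤ 2 * ENNReal.ofReal (K * r ^ s) * ENNReal.ofReal ((2 * r) ^ n) := by
        gcongr
        exact lebesgue_slab_le l a hr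
    _ = ENNReal.ofReal (2 * K * 2 ^ n * r ^ ((n : ℝ) + s)) := by
        rw [← ENNReal.ofReal_ofNat 2, ← ENNReal.ofReal_mul (by positivity),
          ← ENNReal.ofReal_mul (by positivity), Real.rpow_add hr, Real.rpow_natCast]
        congr 1
        ring

/-! ### The support and the upper bound on its dimension. -/

/-- The points of the cube whose coordinates sum up to an element of the Cantor set modulo `1`. -/
def cantorSumSet (ρ : ℝ) (n : ℕ) : Set (Cube (Fin (n + 1))) :=
  {x | ∃ ω, ∃ m : ℤ, ∑ i, x.1 i = cantorPoint ρ ω + m}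

section

variable {ρ : ℝ} (h0 : 0 < ρ) (h1 : ρ < 1)
include h0 h1

open scoped Pointwise in
theorem isClosed_cantorSumSet : IsClosed (cantorSumSet ρ n) := by
  have h : IsClosed (Set.range (cantorPoint ρ) + Set.range ((↑) : ℤ → ℝ)) :=
    Int.isClosedEmbedding_coe_real.isClosed_range.add_left_of_isCompact
      (isCompact_range (continuous_cantorPoint h0 h1))
  have : cantorSumSet ρ n = (fun x : Cube (Fin (n + 1)) => ∑ i, x.1 i) ⁻¹'
      (Set.range (cantorPoint ρ) + Set.range ((↑) : ℤ → ℝ)) := by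
    ext x
    simp [cantorSumSet, Set.mem_add, eq_comm]
  rw [this]
  exact h.preimage (by fun_prop)

theorem support_sumLaw_subset : (sumLaw l (cantorMeasure ρ)).support ⊆ cantorSumSet ρ n := by
  have := isProbabilityMeasure_cantorMeasure h0 h1
  have hcl := isClosed_cantorSumSet (n := n) h0 h1
  refine Measure.support_subset_of_isClosed hcl ?_
  rw [mem_ae_iff, sumLaw, Measure.map_apply (measurable_adjustCoord l) hcl.measurableSet.compl]
  have hC : ∀ᵐ c ∂cantorMeasure ρ, c ∈ Set.range (cantorPoint ρ) := by
    refine (ae_map_iff (continuous_cantorPoint h0 h1).measurable.aemeasurable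
      (isCompact_range (continuous_cantorPoint h0 h1)).measurableSet).2 ?_
    exact Filter.Eventually.of_forall fun ω => ⟨ω, rfl⟩
  have hC' := Measure.quasiMeasurePreserving_snd (μ := Cube.lebesgue (Fin (n + 1))) |>.ae hC
  rw [Set.preimage_compl, ← mem_ae_iff]
  filter_upwards [hC'] with p ⟨ω, hω⟩
  refine ⟨ω, -⌊p.2 - (∑ i, p.1.1 i - p.1.1 l)⌋, ?_⟩
  have hx := Fin.sum_univ_succAbove p.1.1 l
  have hy : ∑ i, (adjustCoord l p.1 p.2).1 (l.succAbove i) = ∑ i, p.1.1 (l.succAbove i) :=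
    Finset.sum_congr rfl fun i _ => adjustCoord_of_ne l p.1 p.2 (Fin.succAbove_ne l i)
  change ∑ i, (adjustCoord l p.1 p.2).1 i = _
  rw [Fin.sum_univ_succAbove _ l, adjustCoord_self, hω, hy, Int.fract]
  push_cast
  linarith

end

end

section

variable {ρ : ℝ} (h0 : 0 < ρ) (h1 : ρ < 1)
include h0 h1

/-- The points whose coordinates sum up to `cantorPoint ρ ω + m`, where the first `k` letters of
`ω` and the cells of mesh size `ρ ^ k` containing all coordinates but one are prescribed. -/
def cantorSumCell (ρ : ℝ) (m : ℤ) {n : ℕ} (k : ℕ) {N : ℕ} (v : Fin n → Fin N) (w : Fin k → Bool) :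
    Set (Cube (Fin (n + 1))) :=
  {x | (∀ i, ⌊x.1 (Fin.succ i) / ρ ^ k⌋₊ = v i) ∧
    ∃ ω : ℕ → Bool, (∀ i : Fin k, ω i = w i) ∧ ∑ i, x.1 i = cantorPoint ρ ω + m}

/-- Coordinate `0` is the sum minus the other `n` coordinates, so it varies by at most `(n + 1) ρ ^
k`; one more factor `n + 1` comes from the crude bound of the distance by the number of coordinates.
-/
theorem ediam_cantorSumCell_le (m : ℤ) {n k N : ℕ} (v : Fin n → Fin N) (w : Fin k → Bool) :
    Metric.ediam (cantorSumCell ρ m k v w) ≤ ENNReal.ofReal ((n + 1) ^ 2 * ρ ^ k) := by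
  have hk : 0 < ρ ^ k := pow_pos h0 k
  refine Metric.ediam_le fun x hx y hy => ?_
  obtain ⟨hxv, ω, hω, hxs⟩ := hx
  obtain ⟨hyv, ω', hω', hys⟩ := hy
  rw [edist_dist]
  refine ENNReal.ofReal_le_ofReal ?_
  have hF : |cantorPoint ρ ω - cantorPoint ρ ω'| ≤ ρ ^ k :=
    abs_cantorPoint_sub_le h0 h1 fun i hi => (hω ⟨i, hi⟩).trans (hω' ⟨i, hi⟩).symm
  have hcell : ∀ i : Fin n, |x.1 i.succ - y.1 i.succ| ≤ ρ ^ k := by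
    intro i
    have hx0 : 0 ≤ x.1 i.succ / ρ ^ k := div_nonneg (x.2 _).1 hk.le
    have hy0 : 0 ≤ y.1 i.succ / ρ ^ k := div_nonneg (y.2 _).1 hk.le
    have a1 := Nat.floor_le hx0
    have a2 := Nat.lt_floor_add_one (x.1 i.succ / ρ ^ k)
    have b1 := Nat.floor_le hy0
    have b2 := Nat.lt_floor_add_one (y.1 i.succ / ρ ^ k)
    rw [hxv i] at a1 a2
    rw [hyv i] at b1 b2
    have : |x.1 i.succ / ρ ^ k - y.1 i.succ / ρ ^ k| ≤ 1 := by
      rw [abs_le]; constructor <;> linarith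
    rwa [← sub_div, abs_div, abs_of_pos hk, div_le_one hk] at this
  have hzero : |x.1 0 - y.1 0| ≤ (n + 1) * ρ ^ k := by
    rw [Fin.sum_univ_succ] at hxs hys
    have e : x.1 0 - y.1 0 = (cantorPoint ρ ω - cantorPoint ρ ω')
        - ∑ i : Fin n, (x.1 i.succ - y.1 i.succ) := by
      rw [Finset.sum_sub_distrib]; linarith
    rw [e]
    refine (abs_sub _ _).trans ?_
    have : |∑ i : Fin n, (x.1 i.succ - y.1 i.succ)| ≤ n * ρ ^ k := by
      refine (Finset.abs_sum_le_sum_abs _ _).trans ?_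
      refine (Finset.sum_le_sum fun i _ => hcell i).trans_eq ?_
      simp
    linarith
  refine (Cube.dist_le_card_mul x y (r := (n + 1) * ρ ^ k) fun i => ?_).trans_eq ?_
  · refine Fin.cases hzero (fun i => (hcell i).trans ?_) i
    have : (0 : ℝ) ≤ n * ρ ^ k := by positivity
    linarith
  · rw [Fintype.card_fin]
    push_cast
    ring

omit h1 in
theorem subset_iUnion_cantorSumCell (m : ℤ) (n k : ℕ) :
    {x : Cube (Fin (n + 1)) | ∃ ω, ∑ i, x.1 i = cantorPoint ρ ω + m} ⊆
      ⋃ p : (Fin n → Fin (⌊(ρ ^ k)⁻¹⌋₊ + 1)) × (Fin k → Bool), cantorSumCell ρ m k p.1 p.2 := by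
  rintro x ⟨ω, hω⟩
  refine Set.mem_iUnion.2 ⟨(fun i => ⟨⌊x.1 (Fin.succ i) / ρ ^ k⌋₊, ?_⟩, fun i => ω i),
    fun i => rfl, ω, fun i => rfl, hω⟩
  rw [Nat.lt_add_one_iff, div_eq_mul_inv]
  refine Nat.floor_le_floor ?_
  have hk : 0 < ρ ^ k := pow_pos h0 k
  exact mul_le_of_le_one_left (by positivity) (x.2 _).2

/-- For each of the countably many `m`, at most `(2ρ⁻ᵏ)ⁿ 2ᵏ` cells of diameter of order `ρᵏ`
suffice. As `(ρᵏ) ^ s = 2⁻ᵏ`, the sum of the diameters to the power `n + s` is bounded independently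
of `k`. -/
theorem dimH_cantorSumSet_le {s : ℝ} (hs : 0 < s) (hρs : ρ ^ s = 1 / 2) (n : ℕ) :
    dimH (cantorSumSet ρ n) ≤ ENNReal.ofReal (n + s) := by
  have hU : cantorSumSet ρ n
      = ⋃ m : ℤ, {x : Cube (Fin (n + 1)) | ∃ ω, ∑ i, x.1 i = cantorPoint ρ ω + m} := by
    ext x
    simp only [cantorSumSet, Set.mem_iUnion, Set.mem_ofPred_eq]
    exact exists_comm
  rw [hU, dimH_iUnion]
  refine iSup_le fun m => ?_
  have ht : 0 ≤ (n : ℝ) + s := by positivity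
  refine dimH_le_of_hausdorffMeasure_ne_top (d := ((n : ℝ) + s).toNNReal) ?_
  rw [Real.coe_toNNReal _ ht]
  refine ne_top_of_le_ne_top
    (ENNReal.ofReal_ne_top (r := 2 ^ n * (((n : ℝ) + 1) ^ 2) ^ ((n : ℝ) + s))) ?_
  have hr : Filter.Tendsto (fun k => ENNReal.ofReal (((n : ℝ) + 1) ^ 2 * ρ ^ k)) Filter.atTop
      (nhds 0) := by
    rw [← ENNReal.ofReal_zero, ← mul_zero (((n : ℝ) + 1) ^ 2)]
    exact ENNReal.tendsto_ofReal
      ((tendsto_pow_atTop_nhds_zero_of_lt_one h0.le h1).const_mul _)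
  refine (Measure.hausdorffMeasure_le_liminf_sum _ _ _ hr
    (fun k (p : (Fin n → Fin (⌊(ρ ^ k)⁻¹⌋₊ + 1)) × (Fin k → Bool)) =>
      cantorSumCell ρ m k p.1 p.2)
    (Filter.Eventually.of_forall fun k p => ediam_cantorSumCell_le h0 h1 m p.1 p.2)
    (Filter.Eventually.of_forall fun k => subset_iUnion_cantorSumCell h0 m n k)).trans ?_
  refine Filter.liminf_le_of_frequently_le' (Filter.Frequently.of_forall fun k => ?_)
  have hk : 0 < ρ ^ k := pow_pos h0 k
  have hk1 : ρ ^ k ≤ 1 := pow_le_one₀ h0.le h1.le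
  have hpow : (ρ ^ k) ^ s = (1 / 2 : ℝ) ^ k := by
    rw [← Real.rpow_natCast, ← Real.rpow_mul h0.le, mul_comm, Real.rpow_mul h0.le, hρs,
      Real.rpow_natCast]
  calc ∑ p : (Fin n → Fin (⌊(ρ ^ k)⁻¹⌋₊ + 1)) × (Fin k → Bool),
        Metric.ediam (cantorSumCell ρ m k p.1 p.2) ^ ((n : ℝ) + s)
      ≤ ∑ _p : (Fin n → Fin (⌊(ρ ^ k)⁻¹⌋₊ + 1)) × (Fin k → Bool),
          ENNReal.ofReal ((((n : ℝ) + 1) ^ 2 * ρ ^ k) ^ ((n : ℝ) + s)) := by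
        refine Finset.sum_le_sum fun p _ => ?_
        rw [← ENNReal.ofReal_rpow_of_nonneg (by positivity) ht]
        exact ENNReal.rpow_le_rpow (ediam_cantorSumCell_le h0 h1 m p.1 p.2) ht
    _ = ENNReal.ofReal (((⌊(ρ ^ k)⁻¹⌋₊ + 1) ^ n * 2 ^ k) *
          (((n : ℝ) + 1) ^ 2 * ρ ^ k) ^ ((n : ℝ) + s)) := by
        have hcard : ((⌊(ρ ^ k)⁻¹⌋₊ : ℝ) + 1) ^ n * 2 ^ k
            = ((((⌊(ρ ^ k)⁻¹⌋₊ + 1) ^ n * 2 ^ k : ℕ)) : ℝ) := by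
          push_cast; rfl
        rw [ENNReal.ofReal_mul (by positivity), hcard, ENNReal.ofReal_natCast]
        simp
    _ ≤ ENNReal.ofReal (2 ^ n * (((n : ℝ) + 1) ^ 2) ^ ((n : ℝ) + s)) := by
        refine ENNReal.ofReal_le_ofReal ?_
        have hfl : ((⌊(ρ ^ k)⁻¹⌋₊ : ℝ) + 1) ≤ 2 * (ρ ^ k)⁻¹ := by
          have := Nat.floor_le (a := (ρ ^ k)⁻¹) (by positivity)
          have := (one_le_inv₀ hk).2 hk1
          linarith
        calc ((⌊(ρ ^ k)⁻¹⌋₊ : ℝ) + 1) ^ n * 2 ^ k * (((n : ℝ) + 1) ^ 2 * ρ ^ k) ^ ((n : ℝ) + s)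
            ≤ (2 * (ρ ^ k)⁻¹) ^ n * 2 ^ k * (((n : ℝ) + 1) ^ 2 * ρ ^ k) ^ ((n : ℝ) + s) := by
              gcongr
          _ = (2 ^ n * (((n : ℝ) + 1) ^ 2) ^ ((n : ℝ) + s))
                * (((ρ ^ k)⁻¹ * ρ ^ k) ^ n * (2 ^ k * (1 / 2) ^ k)) := by
              rw [Real.mul_rpow (by positivity) hk.le, Real.rpow_add hk, Real.rpow_natCast, hpow]
              generalize (1 / 2 : ℝ) ^ k = q
              ring
          _ = 2 ^ n * (((n : ℝ) + 1) ^ 2) ^ ((n : ℝ) + s) := by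
              rw [inv_mul_cancel₀ hk.ne', ← mul_pow]
              norm_num

theorem cantorMeasure_compl_Icc : cantorMeasure ρ (Set.Icc 0 1)ᶜ = 0 := by
  rw [cantorMeasure, Measure.map_apply (continuous_cantorPoint h0 h1).measurable
    measurableSet_Icc.compl]
  convert measure_empty (μ := Measure.infinitePi fun _ : ℕ => fairCoin)
  exact Set.eq_empty_of_forall_notMem fun ω hω => hω (cantorPoint_mem_Icc h0 h1 ω)

end

/-- For every `s ∈ (0,1)` there is a measure on `[0,1]^(n+1)` with uniform `n`-dimensional
marginals, whose support has dimension at most `n + s` and which satisfies a Frostman bound with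
exponent `n + s`. -/
theorem exists_uniformMarginals_frostman {n : ℕ} (hn : 1 ≤ n) {s : ℝ} (hs : 0 < s) (hs1 : s < 1) :
    ∃ ν ∈ uniformMarginals (n + 1), HasFrostmanBound (ν : Measure (Cube (Fin (n + 1)))) (n + s) ∧
      supportDim ν ≤ ENNReal.ofReal (n + s) := by
  -- This solves `ρ ^ s = 1 / 2`; the condition `s < 1` gives `ρ < 1 / 2`, so the Cantor pieces are
  -- separated.
  set ρ : ℝ := (1 / 2) ^ (1 / s) with hρ
  have h0 : 0 < ρ := by positivity
  have hρs : ρ ^ s = 1 / 2 := by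
    rw [hρ, ← Real.rpow_mul (by norm_num), one_div_mul_cancel hs.ne', Real.rpow_one]
  have h2 : ρ < 1 / 2 := by
    calc ρ < (1 / 2 : ℝ) ^ (1 : ℝ) :=
          Real.rpow_lt_rpow_of_exponent_gt (by norm_num) (by norm_num) ((one_lt_div hs).2 hs1)
      _ = 1 / 2 := Real.rpow_one _
  have h1 : ρ < 1 := by linarith
  have := isProbabilityMeasure_cantorMeasure h0 h1
  refine ⟨⟨sumLaw 0 (cantorMeasure ρ), inferInstance⟩,
    mem_uniformMarginals_of_pi (by omega) fun j => map_sumLaw 0 _ j, ?_, ?_⟩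
  · exact sumLaw_frostman 0 (cantorMeasure_compl_Icc h0 h1)
      (cantorMeasure_frostman h0 h1 (by linarith) hs hρs)
  · exact (dimH_mono (support_sumLaw_subset 0 h0 h1)).trans (dimH_cantorSumSet_le h0 h1 hs hρs n)

/-! ### Redistributing mass inside the cells of a grid. -/

/-- The index of the cell of length `1 / (M + 1)` containing a point of `[0,1]`. -/
noncomputable def cellIndex (M : ℕ) (y : ℝ) : ℕ := min ⌊((M : ℝ) + 1) * y⌋₊ M

theorem measurable_cellIndex (M : ℕ) : Measurable (cellIndex M) := by
  unfold cellIndex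
  fun_prop

theorem cellIndex_lt (M : ℕ) (y : ℝ) : cellIndex M y < M + 1 :=
  Nat.lt_add_one_iff.2 (min_le_right _ _)

/-- The cap at `M` puts `y = 1` into the last cell, so the upper bound is not strict. -/
theorem cellIndex_mem {M : ℕ} {y : ℝ} (hy : y ∈ Set.Icc (0 : ℝ) 1) :
    (cellIndex M y : ℝ) ≤ (M + 1) * y ∧ (M + 1) * y ≤ cellIndex M y + 1 := by
  have h0 : 0 ≤ ((M : ℝ) + 1) * y := mul_nonneg (by positivity) hy.1
  have h1 := Nat.floor_le h0
  have h2 := Nat.lt_floor_add_one (((M : ℝ) + 1) * y)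
  unfold cellIndex
  rw [Nat.cast_min]
  refine ⟨(min_le_left _ _).trans h1, ?_⟩
  rcases min_cases (⌊((M : ℝ) + 1) * y⌋₊ : ℝ) (M : ℝ) with ⟨h, -⟩ | ⟨h, -⟩ <;> rw [h]
  · exact h2.le
  · exact mul_le_of_le_one_right (by positivity) hy.2

/-- Replace the relative position of `y` in its cell by `z`. -/
noncomputable def cellReplace (M : ℕ) (y z : ℝ) : ℝ := (cellIndex M y + z) / (M + 1)

theorem measurable_cellReplace (M : ℕ) :
    Measurable fun p : ℝ × ℝ => cellReplace M p.1 p.2 := by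
  have h : Measurable fun y => (cellIndex M y : ℝ) :=
    (measurable_from_top (f := Nat.cast)).comp (measurable_cellIndex M)
  exact ((h.comp measurable_fst).add measurable_snd).div_const _

theorem volume_cellReplace_preimage (M i : ℕ) (s : Set ℝ) :
    volume ({z : ℝ | (i + z) / ((M : ℝ) + 1) ∈ s} ∩ Set.Ico 0 1) * ENNReal.ofReal (1 / (M + 1))
      = volume (s ∩ Set.Ico (i / ((M : ℝ) + 1)) ((i + 1) / (M + 1))) := by
  have hM : (0 : ℝ) < M + 1 := by positivity
  have : {z : ℝ | (i + z) / ((M : ℝ) + 1) ∈ s} ∩ Set.Ico 0 1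
      = ((i : ℝ) + ·) ⁻¹' ((((M : ℝ) + 1)⁻¹ * ·) ⁻¹'
        (s ∩ Set.Ico (i / ((M : ℝ) + 1)) ((i + 1) / (M + 1)))) := by
    ext z
    simp only [Set.mem_inter_iff, Set.mem_ofPred_eq, Set.mem_preimage, Set.mem_Ico,
      inv_mul_eq_div, div_le_div_iff_of_pos_right hM, div_lt_div_iff_of_pos_right hM]
    simp
  rw [this, measure_preimage_add, Real.volume_preimage_mul_left (inv_ne_zero hM.ne'), inv_inv,
    abs_of_pos hM, mul_right_comm, ← ENNReal.ofReal_mul hM.le, mul_one_div_cancel hM.ne',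
    ENNReal.ofReal_one, one_mul]

/-- The cell of `y` is equidistributed, and given the cell the new point is uniform in it; summing
over the cells recovers Lebesgue measure. -/
theorem measurePreserving_cellReplace (M : ℕ) :
    MeasurePreserving (fun p : ℝ × ℝ => cellReplace M p.1 p.2)
      (unitUniform.prod unitUniform) unitUniform := by
  refine ⟨measurable_cellReplace M, ?_⟩
  ext s hs
  have hM : (0 : ℝ) < M + 1 := by positivity
  let J : ℕ → Set ℝ := fun i => Set.Ico (i / ((M : ℝ) + 1)) ((i + 1) / (M + 1))
  have hJ : ∀ i y, y ∈ J i ↔ 0 ≤ y ∧ ⌊((M : ℝ) + 1) * y⌋₊ = i := by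
    intro i y
    simp only [J, Set.mem_Ico, div_le_iff₀ hM, lt_div_iff₀ hM, mul_comm y]
    constructor
    · rintro ⟨h1, h2⟩
      have h3 : 0 ≤ ((M : ℝ) + 1) * y := (Nat.cast_nonneg i).trans h1
      exact ⟨nonneg_of_mul_nonneg_right h3 hM, (Nat.floor_eq_iff h3).2 ⟨h1, h2⟩⟩
    · rintro ⟨h1, h2⟩
      exact (Nat.floor_eq_iff (mul_nonneg hM.le h1)).1 h2
  have hdisj : Set.PairwiseDisjoint (↑(Finset.range (M + 1))) J := by
    intro i _ j _ hij
    refine Set.disjoint_left.2 fun y hi hj => hij ?_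
    rw [← ((hJ i y).1 hi).2, ← ((hJ j y).1 hj).2]
  have hcover : Set.Ico (0 : ℝ) 1 = ⋃ i ∈ Finset.range (M + 1), J i := by
    ext y
    simp only [Set.mem_iUnion, hJ, Finset.mem_range, exists_prop]
    constructor
    · rintro ⟨h0, h1⟩
      refine ⟨_, (Nat.floor_lt (mul_nonneg hM.le h0)).2 ?_, h0, rfl⟩
      push_cast
      nlinarith
    · rintro ⟨i, hi, h0, rfl⟩
      refine ⟨h0, ?_⟩
      have := (Nat.floor_lt (mul_nonneg hM.le h0)).1 hi
      push_cast at this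
      nlinarith
  have hJm : ∀ i, MeasurableSet (J i) := fun i => measurableSet_Ico
  have hc : ∀ i ∈ Finset.range (M + 1), ∀ y ∈ J i, cellIndex M y = i := by
    intro i hi y hy
    rw [cellIndex, ((hJ i y).1 hy).2]
    exact min_eq_left (Nat.lt_add_one_iff.1 (Finset.mem_range.1 hi))
  rw [Measure.map_apply (measurable_cellReplace M) hs,
    Measure.prod_apply (measurable_cellReplace M hs), unitUniform_eq_Ico,
    Measure.restrict_apply hs]
  calc ∫⁻ y in Set.Ico (0 : ℝ) 1, (volume.restrict (Set.Ico (0 : ℝ) 1))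
          (Prod.mk y ⁻¹' ((fun p : ℝ × ℝ => cellReplace M p.1 p.2) ⁻¹' s))
      = ∑ i ∈ Finset.range (M + 1), ∫⁻ y in J i, (volume.restrict (Set.Ico (0 : ℝ) 1))
          (Prod.mk y ⁻¹' ((fun p : ℝ × ℝ => cellReplace M p.1 p.2) ⁻¹' s)) := by
        conv_lhs => rw [hcover]
        rw [lintegral_biUnion_finset hdisj fun i _ => hJm i, ← hcover]
    _ = ∑ i ∈ Finset.range (M + 1), volume (s ∩ J i) := by
        refine Finset.sum_congr rfl fun i hi => ?_
        rw [← volume_cellReplace_preimage, setLIntegral_congr_fun (hJm i)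
          (g := fun _ => volume ({z : ℝ | (i + z) / ((M : ℝ) + 1) ∈ s} ∩ Set.Ico 0 1))]
        · rw [setLIntegral_const, Real.volume_Ico]
          congr 2
          ring
        · intro y hy
          change (volume.restrict (Set.Ico (0 : ℝ) 1)) {z | cellReplace M y z ∈ s} = _
          simp only [cellReplace, hc i hi y hy]
          refine Measure.restrict_apply ?_
          exact (measurable_const.add measurable_id).div_const _ hs
    _ = volume (s ∩ Set.Ico 0 1) := by
        rw [hcover, Set.inter_iUnion₂, measure_biUnion_finset
          (fun i hi j hj hij => (hdisj hi hj hij).mono Set.inter_subset_right Set.inter_subset_right)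
          fun i _ => hs.inter (hJm i)]

section

variable {d : ℕ} (M : ℕ)

/-- The homothety of ratio `1 / (M + 1)` mapping the cube onto its cell with index `v`. -/
noncomputable def cellMap (v : Fin d → Fin (M + 1)) (z : Cube (Fin d)) : Cube (Fin d) :=
  ⟨WithLp.toLp 2 fun i => (v i + z.1 i) / (M + 1), fun i => by
    have h := z.2 i
    have hv : ((v i : ℕ) : ℝ) ≤ M := Nat.cast_le.2 (Nat.lt_add_one_iff.1 (v i).2)
    have hv0 : (0 : ℝ) ≤ (v i : ℕ) := Nat.cast_nonneg _
    constructor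
    · exact div_nonneg (by linarith [h.1]) (by positivity)
    · exact (div_le_one (by positivity)).2 (by linarith [h.2])⟩

theorem cellMap_apply (v : Fin d → Fin (M + 1)) (z : Cube (Fin d)) (i : Fin d) :
    (cellMap M v z).1 i = (v i + z.1 i) / (M + 1) := rfl

theorem lipschitzWith_cellMap (v : Fin d → Fin (M + 1)) : LipschitzWith d (cellMap M v) := by
  refine LipschitzWith.of_dist_le_mul fun z z' => ?_
  refine (Cube.dist_le_card_mul _ _ (r := dist z z') fun i => ?_).trans_eq (by simp)
  have h : (cellMap M v z).1 i - (cellMap M v z').1 i = (z.1 i - z'.1 i) / (M + 1) := by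
    rw [cellMap_apply, cellMap_apply]; ring
  rw [h, abs_div, abs_of_pos (by positivity : (0 : ℝ) < M + 1)]
  exact (div_le_self (abs_nonneg _) (by simp)).trans (Cube.abs_sub_le_dist z z' i)

/-- Replace the relative position of `y` in its cell by `z`. -/
noncomputable def Cube.replace (y z : Cube (Fin d)) : Cube (Fin d) :=
  cellMap M (fun i => ⟨cellIndex M (y.1 i), cellIndex_lt _ _⟩) z

theorem Cube.replace_apply (y z : Cube (Fin d)) (i : Fin d) :
    (Cube.replace M y z).1 i = cellReplace M (y.1 i) (z.1 i) := rfl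

theorem measurable_replace :
    Measurable fun p : Cube (Fin d) × Cube (Fin d) => Cube.replace M p.1 p.2 := by
  refine Measurable.subtype_mk ?_
  refine (WithLp.measurable_toLp 2 _).comp (measurable_pi_iff.2 fun i => ?_)
  exact (measurable_cellReplace M).comp
    (f := fun p : Cube (Fin d) × Cube (Fin d) => (p.1.1 i, p.2.1 i)) (by fun_prop)

theorem dist_replace_le (y z : Cube (Fin d)) : dist y (Cube.replace M y z) ≤ d / (M + 1) := by
  refine (Cube.dist_le_card_mul _ _ (r := 1 / ((M : ℝ) + 1)) fun i => ?_).trans_eq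
    (by rw [Fintype.card_fin]; ring)
  have hM : (0 : ℝ) < M + 1 := by positivity
  obtain ⟨h1, h2⟩ := cellIndex_mem (M := M) (y.2 i)
  obtain ⟨hz0, hz1⟩ := z.2 i
  have h : y.1 i - cellReplace M (y.1 i) (z.1 i)
      = ((M + 1) * y.1 i - (cellIndex M (y.1 i) + z.1 i)) / (M + 1) := by
    rw [cellReplace]; field_simp
  rw [Cube.replace_apply, h, abs_div, abs_of_pos hM]
  gcongr
  rw [abs_le]
  constructor <;> linarith

/-- The measure obtained from `μ` by redistributing the mass of each cell according to a scaled
copy of `ν`. -/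
noncomputable def patch (μ ν : ProbabilityMeasure (Cube (Fin d))) :
    ProbabilityMeasure (Cube (Fin d)) :=
  (μ.prod ν).map (f := fun p : Cube (Fin d) × Cube (Fin d) => Cube.replace M p.1 p.2)
    (measurable_replace M).aemeasurable

theorem coe_patch (μ ν : ProbabilityMeasure (Cube (Fin d))) :
    (patch M μ ν : Measure (Cube (Fin d)))
      = ((μ : Measure (Cube (Fin d))).prod (ν : Measure (Cube (Fin d)))).map
        fun p => Cube.replace M p.1 p.2 := rfl

variable {μ ν : ProbabilityMeasure (Cube (Fin d))}

/-- Replacement acts coordinatewise, so it commutes with dropping coordinate `j`. The remaining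
pairs of coordinates are independent and uniform on the square, and `measurePreserving_cellReplace`
applies to each. -/
theorem patch_mem_uniformMarginals (hd : 2 ≤ d) (hμ : μ ∈ uniformMarginals d)
    (hν : ν ∈ uniformMarginals d) : patch M μ ν ∈ uniformMarginals d := by
  refine mem_uniformMarginals_of_pi hd fun j => ?_
  rw [coe_patch, Measure.map_map (by fun_prop) (measurable_replace M)]
  have h1 := (map_drop_of_mem_uniformMarginals hμ j).prod (map_drop_of_mem_uniformMarginals hν j)
  have h2 := (measurePreserving_arrowProdEquivProdArrow ℝ ℝ {i : Fin d // i ≠ j}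
    (fun _ => unitUniform) (fun _ => unitUniform)).symm
  have h3 := measurePreserving_pi (fun _ : {i : Fin d // i ≠ j} => unitUniform.prod unitUniform)
    (fun _ => unitUniform) fun _ => measurePreserving_cellReplace M
  exact (h3.comp (h2.comp h1)).map_eq

/-- The patched measure lives on finitely many Lipschitz images of the support of `ν`, whose union
is closed by compactness. -/
theorem supportDim_patch_le : supportDim (patch M μ ν) ≤ supportDim ν := by
  have hcl : IsClosed
      (⋃ v : Fin d → Fin (M + 1), cellMap M v '' (ν : Measure (Cube (Fin d))).support) :=
    isClosed_iUnion_of_finite fun v =>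
      (Measure.isClosed_support.isCompact.image (lipschitzWith_cellMap M v).continuous).isClosed
  have hsub : (patch M μ ν : Measure (Cube (Fin d))).support
      ⊆ ⋃ v : Fin d → Fin (M + 1), cellMap M v '' (ν : Measure (Cube (Fin d))).support := by
    refine Measure.support_subset_of_isClosed hcl ?_
    rw [coe_patch, mem_ae_map_iff (measurable_replace M).aemeasurable hcl.measurableSet]
    have hν : ∀ᵐ z ∂(ν : Measure (Cube (Fin d))), z ∈ (ν : Measure (Cube (Fin d))).support :=
      Measure.support_mem_ae
    filter_upwards [(Measure.quasiMeasurePreserving_snd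
      (μ := (μ : Measure (Cube (Fin d))))).ae hν] with p hp
    exact Set.mem_iUnion.2 ⟨_, p.2, hp, rfl⟩
  refine (dimH_mono hsub).trans ?_
  rw [dimH_iUnion]
  exact iSup_le fun v => (lipschitzWith_cellMap M v).dimH_image_le _

/-- For fixed `y`, undoing the homothety enlarges diameters by at most `d (M + 1)`. This changes the
constant but not the exponent. -/
theorem patch_frostman (hd : 0 < d) {t : ℝ}
    (h : HasFrostmanBound (ν : Measure (Cube (Fin d))) t) :
    HasFrostmanBound (patch M μ ν : Measure (Cube (Fin d))) t := by
  obtain ⟨K, hK, h⟩ := h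
  have hL : (0 : ℝ) < d * (M + 1) := by positivity
  refine ⟨K * (d * (M + 1)) ^ t, by positivity, fun r hr A hA hAr => ?_⟩
  rw [coe_patch, Measure.map_apply (measurable_replace M) hA,
    Measure.prod_apply (measurable_replace M hA), mul_assoc, ← Real.mul_rpow hL.le hr.le]
  have key : ∀ y, (ν : Measure (Cube (Fin d)))
      (Prod.mk y ⁻¹' ((fun p => Cube.replace M p.1 p.2) ⁻¹' A))
        ≤ ENNReal.ofReal (K * (d * (M + 1) * r) ^ t) := by
    intro y
    refine h _ (by positivity) _ (measurable_prodMk_left (measurable_replace M hA)) ?_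
    intro z hz z' hz'
    refine (Cube.dist_le_card_mul z z' (r := (M + 1) * r) fun i => ?_).trans_eq
      (by rw [Fintype.card_fin]; ring)
    have hM : (0 : ℝ) < M + 1 := by positivity
    have h1 := (Cube.abs_sub_le_dist _ _ i).trans (hAr _ hz _ hz')
    have h2 : cellReplace M (y.1 i) (z.1 i) - cellReplace M (y.1 i) (z'.1 i)
        = (z.1 i - z'.1 i) / (M + 1) := by
      rw [cellReplace, cellReplace]; ring
    rwa [Cube.replace_apply, Cube.replace_apply, h2, abs_div, abs_of_pos hM, div_le_iff₀ hM,
      mul_comm r] at h1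
  refine (lintegral_mono key).trans_eq ?_
  simp

/-- The pair `(y, Cube.replace M y z)` is a coupling of the two measures, and its points share a
cell. -/
theorem hutchinson_patch_le : hutchinson μ (patch M μ ν) ≤ d / (M + 1) := by
  refine Real.sSup_le ?_ (by positivity)
  rintro _ ⟨g, hg, rfl⟩
  obtain ⟨C, hC⟩ := isCompact_univ.exists_bound_of_continuousOn hg.continuous.continuousOn
  have hint : ∀ f : Cube (Fin d) × Cube (Fin d) → Cube (Fin d), Measurable f →
      Integrable (fun p => g (f p))
        ((μ : Measure (Cube (Fin d))).prod (ν : Measure (Cube (Fin d)))) := fun f hf =>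
    Integrable.of_bound (hg.continuous.measurable.comp hf).aestronglyMeasurable C
      (Filter.Eventually.of_forall fun p => hC _ (Set.mem_univ _))
  have h1 : ∫ x, g x ∂(μ : Measure (Cube (Fin d)))
      = ∫ p, g p.1 ∂(μ : Measure (Cube (Fin d))).prod (ν : Measure (Cube (Fin d))) := by
    have hfst := measurePreserving_fst (μ := (μ : Measure (Cube (Fin d))))
      (ν := (ν : Measure (Cube (Fin d))))
    rw [← hfst.map_eq, integral_map measurable_fst.aemeasurable
      hg.continuous.measurable.aestronglyMeasurable, hfst.map_eq]
  rw [h1, coe_patch, integral_map (measurable_replace M).aemeasurable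
      hg.continuous.measurable.aestronglyMeasurable,
    ← integral_sub (hint _ measurable_fst) (hint _ (measurable_replace M))]
  refine (integral_mono ((hint _ measurable_fst).sub (hint _ (measurable_replace M)))
    (integrable_const ((d : ℝ) / (M + 1))) fun p => ?_).trans_eq (by simp)
  have h2 := hg.dist_le_mul p.1 (Cube.replace M p.1 p.2)
  rw [NNReal.coe_one, one_mul, Real.dist_eq] at h2
  exact ((le_abs_self _).trans h2).trans (dist_replace_le M p.1 p.2)

end

/-! ### Exact dimension and density. -/

theorem supportDim_eq_of_frostman {d : ℕ} {ν : ProbabilityMeasure (Cube (Fin d))} {t : ℝ}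
    (ht : 0 < t) (h : HasFrostmanBound (ν : Measure (Cube (Fin d))) t)
    (hle : supportDim ν ≤ ENNReal.ofReal t) : supportDim ν = ENNReal.ofReal t := by
  refine le_antisymm hle (h.le_dimH ht ?_)
  rw [(prob_compl_eq_zero_iff₀ Measure.nullMeasurableSet_support).1 Measure.measure_compl_support]
  exact one_ne_zero

theorem hutchinsonDense_supportDim_eq {n : ℕ} (hn : 1 ≤ n) {s : ℝ} (hs : 0 < s) (hs1 : s < 1) :
    HutchinsonDense {μ ∈ uniformMarginals (n + 1) | supportDim μ = ENNReal.ofReal (n + s)}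
      (uniformMarginals (n + 1)) := by
  refine ⟨fun μ hμ => hμ.1, fun μ hμ ε hε => ?_⟩
  obtain ⟨ν, hν, hF, hdim⟩ := exists_uniformMarginals_frostman hn hs hs1
  obtain ⟨M, hM⟩ := exists_nat_gt (((n + 1 : ℕ) : ℝ) / ε)
  refine ⟨patch M μ ν, ⟨patch_mem_uniformMarginals M (by omega) hμ hν,
    supportDim_eq_of_frostman (by positivity) (patch_frostman M n.succ_pos hF)
      ((supportDim_patch_le M).trans hdim)⟩, (hutchinson_patch_le M).trans_lt ?_⟩
  rw [div_lt_iff₀ hε] at hM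
  rw [div_lt_iff₀ (by positivity)]
  linarith

theorem HutchinsonDense.mono {Ω : Type*} [MetricSpace Ω] [MeasurableSpace Ω]
    {F G P : Set (ProbabilityMeasure Ω)} (h : HutchinsonDense F P) (hFG : F ⊆ G) (hG : G ⊆ P) :
    HutchinsonDense G P :=
  ⟨hG, fun μ hμ ε hε => (h.2 μ hμ ε hε).imp fun _ hν => ⟨hFG hν.1, hν.2⟩⟩

theorem theorem5p3 (d : ℕ) (hd : 3 ≤ d) :
    HutchinsonDense
      {μ ∈ uniformMarginals d | supportDim μ ≠ ⊤ ∧ ∀ n : ℕ, supportDim μ ≠ (n : ENNReal)}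
      (uniformMarginals d) ∧
    ∀ a b : ℝ, (d : ℝ) - 1 ≤ a → a < b → b ≤ (d : ℝ) →
      HutchinsonDense
        {μ ∈ uniformMarginals d |
          supportDim μ ∈ Set.Ioo (ENNReal.ofReal a) (ENNReal.ofReal b)}
        (uniformMarginals d) := by
  obtain ⟨n, rfl⟩ : ∃ n, d = n + 1 := ⟨d - 1, by omega⟩
  have hn : 1 ≤ n := by omega
  push_cast
  constructor
  · refine (hutchinsonDense_supportDim_eq hn (s := 1 / 2) (by norm_num) (by norm_num)).mono ?_
      fun μ hμ => hμ.1
    rintro μ ⟨hμ, hdim⟩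
    refine ⟨hμ, hdim ▸ ENNReal.ofReal_ne_top, fun m hm => ?_⟩
    rw [hdim, ← ENNReal.ofReal_natCast, ENNReal.ofReal_eq_ofReal_iff (by positivity)
      (by positivity)] at hm
    have h1 : (n : ℝ) < m := by linarith
    have h2 : (m : ℝ) < (n + 1 : ℕ) := by push_cast; linarith
    have h3 := Nat.cast_lt.1 h1
    have h4 := Nat.cast_lt.1 h2
    omega
  · intro a b ha hab hb
    -- The target dimension is the midpoint of `(a, b)`; `n ≤ a < b ≤ n + 1` places `s` in `(0,1)`.
    refine (hutchinsonDense_supportDim_eq hn (s := (a + b) / 2 - n) (by linarith)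
      (by linarith)).mono ?_ fun μ hμ => hμ.1
    rintro μ ⟨hμ, hdim⟩
    refine ⟨hμ, ?_⟩
    have hn0 : (0 : ℝ) ≤ n := by positivity
    rw [hdim]
    constructor
    · exact (ENNReal.ofReal_lt_ofReal_iff (by linarith)).2 (by linarith)
    · exact (ENNReal.ofReal_lt_ofReal_iff (by linarith)).2 (by linarith)
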